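/- Let $\mathbb T=\mathbb R/\mathbb Z$ be the circle group and let $I=[0,1]$ with Lebesgue measure $\mu$. For $g\in\mathbb T$ and $t\in(0,1]$ let $g_t\colon I\to\mathbb T$ be the function with $g_t(x)=g$ for $x<t$ and $g_t(x)=0$ for $x\ge t$. Let $HM(\mathbb T)$ be the subgroup of $\mathbb T^I$ generated by all the functions $g_t$ ($g\in\mathbb T$, $t\in(0,1]$), equipped with the group topology for which the sets $$O(U,\varepsilon)=\{f\in HM(\mathbb T):\mu(\{t\in I: f(t)\notin U\})<\varepsilon\},$$ with $U$ an open neighbourhood of $0$ in $\mathbb T$ and $\varepsilon>0$, form a base at the identity. Theorem. Let $G$ be a countable abelian group satisfying at least one of the following conditions: (a) the torsion part $t(G)$ of $G$ is unbounded, that is, there is no integer $m\ge 1$ with $m\,t(G)=\{0\}$; (b) the (torsion-free) rank of $G$, that is, the maximal cardinality of a $\mathbb Z$-linearly independent subset of $G$, is infinite. Then $G$ is algebraically isomorphic (isomorphic as an abstract group) to a dense subgroup of $HM(\mathbb T)$. -/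

import Mathlib

open MeasureTheory

/-- The step function `g_t : [0,1] → A`, equal to `g` on `[0,t)` and to `0` on `[t,1]`. -/
noncomputable def hmStep {A : Type*} [AddCommGroup A] (t : unitInterval) (g : A) :
    unitInterval → A :=
  Set.indicator (Set.Iio t) (fun _ => g)

/-- The subgroup of `A^[0,1]` generated by all step functions `g_t` with `g ∈ A`, `t ∈ (0,1]`,
that is, the sum of the subgroups `A_t = {g_t : g ∈ A}` over `t ∈ (0,1]`. -/
def hmSubgroup (A : Type*) [AddCommGroup A] : AddSubgroup (unitInterval → A) :=
  AddSubgroup.closure {f | ∃ t : unitInterval, 0 < t ∧ ∃ g : A, f = hmStep t g}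

/-- The Hartman–Mycielski group of an abelian group `A`. It is a type of its own (and not just
the coercion of `hmSubgroup A` to a type), so that it does not inherit the topology of
pointwise convergence. -/
def HM (A : Type*) [AddCommGroup A] : Type _ := ↥(hmSubgroup A)

namespace HM

instance (A : Type*) [AddCommGroup A] : AddCommGroup (HM A) :=
  inferInstanceAs (AddCommGroup (hmSubgroup A))

instance (A : Type*) [AddCommGroup A] : CoeFun (HM A) (fun _ => unitInterval → A) :=
  ⟨fun f => f.1⟩

/-- The set `O(U, ε)` of all `f ∈ HM(A)` such that `{t ∈ [0,1] : f(t) ∉ U}` has Lebesgue measure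
less than `ε`. -/
def nhd {A : Type*} [AddCommGroup A] (U : Set A) (ε : ℝ) : Set (HM A) :=
  {f | volume {t : unitInterval | f t ∉ U} < ENNReal.ofReal ε}

/-- The sets `O(U, ε)`, with `U` an open neighbourhood of `0` in `A` and `ε > 0`, form a base at
`0` of a group topology on `HM(A)`. -/
@[reducible] def filterBasis (A : Type*) [AddCommGroup A] [TopologicalSpace A]
    [IsTopologicalAddGroup A] : AddGroupFilterBasis (HM A) :=
  addGroupFilterBasisOfComm
    {O | ∃ U : Set A, IsOpen U ∧ (0 : A) ∈ U ∧ ∃ ε : ℝ, 0 < ε ∧ O = nhd U ε}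
    ⟨nhd Set.univ 1, Set.univ, isOpen_univ, Set.mem_univ _, 1, one_pos, rfl⟩
    (by
      rintro _ _ ⟨U, hU, hU0, ε, hε, rfl⟩ ⟨V, hV, hV0, δ, hδ, rfl⟩
      refine ⟨nhd (U ∩ V) (min ε δ),
        ⟨U ∩ V, hU.inter hV, ⟨hU0, hV0⟩, min ε δ, lt_min hε hδ, rfl⟩, ?_⟩
      intro f hf
      have hf' : volume {t : unitInterval | f t ∉ U ∩ V} < ENNReal.ofReal (min ε δ) := hf
      have h1 : {t : unitInterval | f t ∉ U} ⊆ {t : unitInterval | f t ∉ U ∩ V} :=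
        fun t ht h => ht h.1
      have h2 : {t : unitInterval | f t ∉ V} ⊆ {t : unitInterval | f t ∉ U ∩ V} :=
        fun t ht h => ht h.2
      exact ⟨lt_of_le_of_lt (measure_mono h1)
          (hf'.trans_le (ENNReal.ofReal_le_ofReal (min_le_left _ _))),
        lt_of_le_of_lt (measure_mono h2)
          (hf'.trans_le (ENNReal.ofReal_le_ofReal (min_le_right _ _)))⟩)
    (by
      rintro _ ⟨U, hU, hU0, ε, hε, rfl⟩
      have h : {t : unitInterval | (0 : HM A) t ∉ U} = ∅ :=
        Set.eq_empty_of_forall_notMem fun t ht => ht hU0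
      change volume {t : unitInterval | (0 : HM A) t ∉ U} < ENNReal.ofReal ε
      rw [h, measure_empty]
      exact ENNReal.ofReal_pos.2 hε)
    (by
      rintro _ ⟨U, hU, hU0, ε, hε, rfl⟩
      obtain ⟨V, hV, hV0, hVU⟩ := exists_open_nhds_zero_add_subset (hU.mem_nhds hU0)
      refine ⟨nhd V (ε / 2), ⟨V, hV, hV0, ε / 2, half_pos hε, rfl⟩, ?_⟩
      rintro _ ⟨f, hf, g, hg, rfl⟩
      have hf' : volume {t : unitInterval | f t ∉ V} < ENNReal.ofReal (ε / 2) := hf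
      have hg' : volume {t : unitInterval | g t ∉ V} < ENNReal.ofReal (ε / 2) := hg
      change volume {t : unitInterval | f t + g t ∉ U} < ENNReal.ofReal ε
      have hsub : {t : unitInterval | f t + g t ∉ U} ⊆
          {t : unitInterval | f t ∉ V} ∪ {t : unitInterval | g t ∉ V} := by
        intro t ht
        by_contra hc
        rw [Set.mem_union, not_or] at hc
        exact ht (hVU (Set.add_mem_add (not_not.1 hc.1) (not_not.1 hc.2)))
      calc volume {t : unitInterval | f t + g t ∉ U}
          ≤ volume {t : unitInterval | f t ∉ V} + volume {t : unitInterval | g t ∉ V} :=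
            (measure_mono hsub).trans (measure_union_le _ _)
        _ < ENNReal.ofReal (ε / 2) + ENNReal.ofReal (ε / 2) := ENNReal.add_lt_add hf' hg'
        _ = ENNReal.ofReal ε := by
            rw [← ENNReal.ofReal_add (half_pos hε).le (half_pos hε).le, add_halves])
    (by
      rintro _ ⟨U, hU, hU0, ε, hε, rfl⟩
      refine ⟨nhd (-U) ε, ⟨-U, hU.neg, by simpa using hU0, ε, hε, rfl⟩, ?_⟩
      intro f hf
      exact hf)

/-- The Hartman–Mycielski topology on `HM(A)`. -/
instance (A : Type*) [AddCommGroup A] [TopologicalSpace A] [IsTopologicalAddGroup A] :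
    TopologicalSpace (HM A) :=
  (filterBasis A).topology

instance (A : Type*) [AddCommGroup A] [TopologicalSpace A] [IsTopologicalAddGroup A] :
    IsTopologicalAddGroup (HM A) :=
  (filterBasis A).isTopologicalAddGroup

end HM

/-! The dense copy of `G` is the limit of finite approximations: finitely generated graphs `Γ` of
isomorphisms between subgroups of `G` and of `HM(𝕋)`. As `G` is countable and `HM(𝕋)` separable,
countably many requirements (each `g` lies in the domain; each basic neighbourhood of each point of
a countable dense set meets the range) suffice, and each is met by extending `Γ`.

Let `g` have order `k` modulo the domain, with `k = 0` for infinite order. Since `𝕋` is divisible,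
some `f₀` has `k • f₀` equal to the value prescribed at `k • g`. Send `g` to `f₀ + c_t`, where `c`
has order `k` and `t` is small. A finitely generated subgroup of `HM(𝕋)` has finitely many jump
points, so for any other `t > 0` it contains no nonzero step at `t`, and no new relation appears
(`exists_partialIso_extension`).

For density, `f₀` can be taken uniformly `1/k`-close to any target, or equal to it if `k = 0`. So
`k` must be `0` or large, which (a) or (b) provides: either makes `G` modulo a finitely generated
subgroup unbounded (`exists_nsmul_notMem_of_fg`). -/

/-- The functions `[0,1] → A` vanishing at `1` that can jump, from the left, only at points
of `S`. -/
def stepSubgroup (A : Type*) [AddCommGroup A] (S : Finset unitInterval) :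
    AddSubgroup (unitInterval → A) where
  carrier := {f | f 1 = 0 ∧ ∀ x y, x ≤ y → (∀ s ∈ S, s ≤ x ∨ y < s) → f x = f y}
  zero_mem' := ⟨rfl, fun _ _ _ _ => rfl⟩
  add_mem' := fun {f g} hf hg => ⟨by simp [hf.1, hg.1], fun x y hxy hS => by
    simp [hf.2 x y hxy hS, hg.2 x y hxy hS]⟩
  neg_mem' := fun {f} hf => ⟨by simp [hf.1], fun x y hxy hS => by simp [hf.2 x y hxy hS]⟩

/-! ### Elements of `HM(A)` as functions with finitely many jumps -/

section Step

variable {A : Type*} [AddCommGroup A]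

theorem stepSubgroup_mono {S T : Finset unitInterval} (h : S ⊆ T) :
    stepSubgroup A S ≤ stepSubgroup A T :=
  fun _ hf => ⟨hf.1, fun x y hxy hT => hf.2 x y hxy fun s hs => hT s (h hs)⟩

theorem hmStep_apply (t x : unitInterval) (g : A) [Decidable (x < t)] :
    hmStep t g x = if x < t then g else 0 := by
  simp [hmStep, Set.indicator_apply]

theorem hmStep_mem_hmSubgroup (t : unitInterval) (g : A) : hmStep t g ∈ hmSubgroup A := by
  rcases eq_or_lt_of_le (zero_le : 0 ≤ t) with rfl | ht
  · have : hmStep (0 : unitInterval) g = 0 := by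
      funext x
      classical
      rw [hmStep_apply, if_neg (not_lt.2 (zero_le : 0 ≤ x))]
      rfl
    rw [this]
    exact zero_mem _
  · exact AddSubgroup.subset_closure ⟨t, ht, g, rfl⟩

theorem hmStep_mem_stepSubgroup (t : unitInterval) (g : A) : hmStep t g ∈ stepSubgroup A {t} := by
  classical
  refine ⟨?_, fun x y hxy h => ?_⟩
  · rw [hmStep_apply, if_neg (not_lt.2 unitInterval.le_one')]
  · rw [hmStep_apply, hmStep_apply]
    rcases h t (Finset.mem_singleton_self t) with h | h
    · rw [if_neg (not_lt.2 h), if_neg (not_lt.2 (h.trans hxy))]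
    · rw [if_pos h, if_pos (hxy.trans_lt h)]

/-- Induction on the largest jump `s`: with `s'` the previous jump (or `0`), `f` equals `f s'` on
`[s', s)` and `0` from `s` on, so subtracting one step removes the jump at `s`. -/
theorem mem_hmSubgroup_of_mem_stepSubgroup (S : Finset unitInterval) :
    ∀ f : unitInterval → A, f ∈ stepSubgroup A S → f ∈ hmSubgroup A := by
  classical
  induction S using Finset.induction_on_max with
  | empty =>
    intro f hf
    have : f = 0 := by
      funext x
      rw [hf.2 x 1 x.2.2 (by simp), hf.1]
      rfl
    rw [this]
    exact zero_mem _
  | insert s S hs ih =>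
    intro f hf
    set s' := S.sup id with hs'
    have hle : ∀ u ∈ S, u ≤ s' := fun u hu => Finset.le_sup (f := id) hu
    have key : f - hmStep s (f s') ∈ stepSubgroup A S := by
      refine ⟨?_, fun x y hxy h => ?_⟩
      · simp [hmStep_apply, hf.1, not_lt.2 (unitInterval.le_one' (t := s))]
      · simp only [Pi.sub_apply, hmStep_apply]
        by_cases hc : x < s ∧ s ≤ y
        · have hx : s' ≤ x := Finset.sup_le fun u hu =>
            (h u hu).resolve_right (not_lt.2 ((hs u hu).le.trans hc.2))
          rw [if_pos hc.1, if_neg (not_lt.2 hc.2), sub_zero,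
            hf.2 y 1 y.2.2, hf.1, hf.2 s' x hx, sub_self]
          · intro u hu
            rcases Finset.mem_insert.1 hu with rfl | hu
            · exact Or.inr hc.1
            · exact Or.inl (hle u hu)
          · intro u hu
            rcases Finset.mem_insert.1 hu with rfl | hu
            · exact Or.inl hc.2
            · exact Or.inl ((hs u hu).le.trans hc.2)
        · have hiff : x < s ↔ y < s :=
            ⟨fun hx => not_le.1 fun hy => hc ⟨hx, hy⟩, fun hy => hxy.trans_lt hy⟩
          rw [hf.2 x y hxy]
          · simp only [hiff]
          · intro u hu
            rcases Finset.mem_insert.1 hu with rfl | hu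
            · by_contra hcon
              rw [not_or, not_le, not_lt] at hcon
              exact hc hcon
            · exact h u hu
    have := add_mem (ih _ key) (hmStep_mem_hmSubgroup s (f s'))
    rwa [sub_add_cancel] at this

theorem mem_hmSubgroup_iff {f : unitInterval → A} :
    f ∈ hmSubgroup A ↔ ∃ S, f ∈ stepSubgroup A S := by
  classical
  refine ⟨fun hf => ?_, fun ⟨S, hf⟩ => mem_hmSubgroup_of_mem_stepSubgroup S f hf⟩
  induction hf using AddSubgroup.closure_induction with
  | mem x hx =>
    obtain ⟨t, -, g, rfl⟩ := hx
    exact ⟨_, hmStep_mem_stepSubgroup t g⟩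
  | zero => exact ⟨∅, zero_mem _⟩
  | add x y _ _ hx hy =>
    obtain ⟨S, hS⟩ := hx
    obtain ⟨T, hT⟩ := hy
    exact ⟨S ∪ T, add_mem (stepSubgroup_mono Finset.subset_union_left hS)
      (stepSubgroup_mono Finset.subset_union_right hT)⟩
  | neg x _ hx =>
    obtain ⟨S, hS⟩ := hx
    exact ⟨S, neg_mem hS⟩

end Step

/-! ### Pointwise operations and finitely generated subgroups of `HM(A)` -/

namespace HM

section Algebra

variable {A : Type*} [AddCommGroup A]

@[ext] theorem ext {f g : HM A} (h : ∀ x, f x = g x) : f = g := Subtype.ext (funext h)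

theorem add_apply (f g : HM A) (x : unitInterval) : (f + g) x = f x + g x := rfl

theorem sub_apply (f g : HM A) (x : unitInterval) : (f - g) x = f x - g x := rfl

theorem zsmul_apply (n : ℤ) (f : HM A) (x : unitInterval) : (n • f) x = n • f x := rfl

theorem apply_one (f : HM A) : f 1 = 0 := by
  obtain ⟨S, hS⟩ := mem_hmSubgroup_iff.1 f.2
  exact hS.1

/-- The step function `g_t` as an element of `HM A`. -/
noncomputable def step (t : unitInterval) (g : A) : HM A := ⟨hmStep t g, hmStep_mem_hmSubgroup t g⟩

theorem step_apply (t x : unitInterval) (g : A) [Decidable (x < t)] :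
    step t g x = if x < t then g else 0 :=
  hmStep_apply t x g

theorem zsmul_step (n : ℤ) (t : unitInterval) (g : A) : n • step t g = step t (n • g) := by
  classical
  ext x
  rw [zsmul_apply, step_apply, step_apply]
  split_ifs <;> simp

theorem step_zero (t : unitInterval) : step t (0 : A) = 0 := by
  have := zsmul_step 0 t (0 : A)
  rwa [zero_smul, zero_smul, eq_comm] at this

/-- The coercion of `HM A` to functions as a homomorphism. -/
def coeHom (A : Type*) [AddCommGroup A] : HM A →+ (unitInterval → A) := (hmSubgroup A).subtype

theorem closure_step : AddSubgroup.closure {f : HM A | ∃ t g, f = step t g} = ⊤ := by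
  rw [eq_top_iff]
  rintro ⟨f, hf⟩ -
  induction hf using AddSubgroup.closure_induction with
  | mem x hx =>
    obtain ⟨t, -, g, rfl⟩ := hx
    exact AddSubgroup.subset_closure ⟨t, g, rfl⟩
  | zero => exact zero_mem _
  | add x y hx hy hx' hy' => exact add_mem hx' hy'
  | neg x hx hx' => exact neg_mem hx'

/-- Applying a binary operation fixing `0` to two elements of `HM A`. -/
theorem exists_map₂ (F : A → A → A) (hF : F 0 0 = 0) (f g : HM A) :
    ∃ h : HM A, ∀ x, h x = F (f x) (g x) := by
  classical
  obtain ⟨S, hS⟩ := mem_hmSubgroup_iff.1 f.2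
  obtain ⟨T, hT⟩ := mem_hmSubgroup_iff.1 g.2
  have hS' := stepSubgroup_mono (Finset.subset_union_left (s₂ := T)) hS
  have hT' := stepSubgroup_mono (Finset.subset_union_right (s₁ := S)) hT
  refine ⟨⟨fun x => F (f x) (g x), mem_hmSubgroup_iff.2 ⟨S ∪ T, ?_, fun x y hxy h => ?_⟩⟩,
    fun x => rfl⟩
  · simp only [apply_one, hF]
  · exact congrArg₂ F (hS'.2 x y hxy h) (hT'.2 x y hxy h)

theorem exists_le_stepSubgroup {K : AddSubgroup (HM A)} (hK : K.FG) :
    ∃ S, K ≤ (stepSubgroup A S).comap (coeHom A) := by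
  classical
  obtain ⟨X, rfl⟩ := hK
  choose S hS using fun f : HM A => mem_hmSubgroup_iff.1 f.2
  refine ⟨X.biUnion S, (AddSubgroup.closure_le _).2 fun f hf => ?_⟩
  exact stepSubgroup_mono (Finset.subset_biUnion_of_mem S hf) (hS f)

/-- A finitely generated subgroup of `HM A` contains no nonzero step `g_t` for some
arbitrarily small `t`. -/
theorem exists_step_mem_imp {K : AddSubgroup (HM A)} (hK : K.FG) {ε : ℝ} (hε : 0 < ε) :
    ∃ t : unitInterval, (t : ℝ) < ε ∧ ∀ g : A, step t g ∈ K → g = 0 := by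
  classical
  obtain ⟨S, hS⟩ := exists_le_stepSubgroup hK
  obtain ⟨δ, hδ, hδε⟩ : ∃ δ : unitInterval, 0 < δ ∧ (δ : ℝ) ≤ ε :=
    ⟨⟨min ε 1, (lt_min hε one_pos).le, min_le_right _ _⟩, lt_min hε one_pos, min_le_left _ _⟩
  obtain ⟨t, ⟨ht0, htδ⟩, htS⟩ := (Set.Ioo_infinite hδ).exists_notMem_finset S
  refine ⟨t, lt_of_lt_of_le htδ hδε, fun g hg => ?_⟩
  -- With `x` the last point of `S` before `t` (or `0`), there is no jump in `(x, t]`, so members of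
  -- `K` agree at `x` and `t`, where `step t g` takes the values `g` and `0`.
  have hne : (insert 0 (S.filter (· < t))).Nonempty := Finset.insert_nonempty _ _
  set x := (insert 0 (S.filter (· < t))).max' hne with hx
  have hxt : x < t := by
    rw [hx, Finset.max'_lt_iff]
    intro y hy
    rcases Finset.mem_insert.1 hy with rfl | hy
    · exact ht0
    · exact (Finset.mem_filter.1 hy).2
  have h := (hS hg).2 x t hxt.le fun s hs => by
    rcases lt_trichotomy s t with h | h | h
    · exact Or.inl (Finset.le_max' _ _ (Finset.mem_insert_of_mem (Finset.mem_filter.2 ⟨hs, h⟩)))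
    · exact absurd (h ▸ hs) htS
    · exact Or.inr h
  have h' : step t g x = step t g t := h
  rwa [step_apply, step_apply, if_pos hxt, if_neg (lt_irrefl t)] at h'

end Algebra

end HM

/-! ### Partial isomorphisms and their one-element extensions -/

theorem AddSubgroup.FG.map_hom {M N : Type*} [AddGroup M] [AddGroup N] {K : AddSubgroup M}
    (hK : K.FG) (f : M →+ N) : (K.map f).FG := by
  classical
  obtain ⟨X, rfl⟩ := hK
  exact ⟨X.image f, by rw [Finset.coe_image, AddMonoidHom.map_closure]⟩

theorem AddSubgroup.fg_zmultiples {M : Type*} [AddGroup M] (x : M) :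
    (AddSubgroup.zmultiples x).FG :=
  ⟨{x}, by rw [Finset.coe_singleton, AddSubgroup.zmultiples_eq_closure]⟩

theorem AddSubgroup.exists_dvd_iff_zsmul_mem {G : Type*} [AddCommGroup G] (H : AddSubgroup G)
    (g : G) : ∃ k : ℕ, ∀ j : ℤ, j • g ∈ H ↔ (k : ℤ) ∣ j := by
  refine ⟨addOrderOf (QuotientAddGroup.mk g : G ⧸ H), fun j => ?_⟩
  rw [addOrderOf_dvd_iff_zsmul_eq_zero, ← QuotientAddGroup.eq_zero_iff]
  rfl

/-- `Γ` is the graph of an isomorphism between subgroups of `G` and of `B`. -/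
def AddSubgroup.IsPartialIso {G B : Type*} [AddCommGroup G] [AddCommGroup B]
    (Γ : AddSubgroup (G × B)) : Prop :=
  ∀ z ∈ Γ, z.1 = 0 ↔ z.2 = 0

namespace HM

variable {A G : Type*} [AddCommGroup A] [AddCommGroup G]

/-- A finitely generated partial isomorphism extends to `g`, with value `f₀ + g_t`, whenever `f₀`
is compatible with it and `c` has the order of `g` modulo its domain; `t` may be
arbitrarily small. -/
theorem exists_partialIso_extension {Γ : AddSubgroup (G × HM A)} (hfg : Γ.FG)
    (hΓ : Γ.IsPartialIso) {g : G} {f₀ : HM A} {k : ℕ}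
    (hk : ((k : ℤ) • g, (k : ℤ) • f₀) ∈ Γ)
    (hg : ∀ j : ℤ, j • g ∈ Γ.map (AddMonoidHom.fst G (HM A)) → (k : ℤ) ∣ j)
    {c : A} (hc : addOrderOf c = k) {ε : ℝ} (hε : 0 < ε) :
    ∃ Γ' : AddSubgroup (G × HM A), Γ ≤ Γ' ∧ Γ'.FG ∧ Γ'.IsPartialIso ∧
      ∃ t : unitInterval, (t : ℝ) < ε ∧ (g, f₀ + step t c) ∈ Γ' := by
  -- Adjoining `f₀` to the range matters: a relation `y.2 + j • (f₀ + step t c) = 0` then puts `step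
  -- t (j • c)` in this subgroup, forcing `j • c = 0`, that is, `k ∣ j`.
  have hKfg : (Γ.map (AddMonoidHom.snd G (HM A)) ⊔ AddSubgroup.zmultiples f₀).FG :=
    (hfg.map_hom _).sup (AddSubgroup.fg_zmultiples f₀)
  obtain ⟨t, htε, ht⟩ := exists_step_mem_imp hKfg hε
  refine ⟨Γ ⊔ AddSubgroup.zmultiples (g, f₀ + step t c), le_sup_left,
    hfg.sup (AddSubgroup.fg_zmultiples _), ?_, t, htε,
    (le_sup_right : _ ≤ Γ ⊔ _) (AddSubgroup.mem_zmultiples _)⟩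
  intro z hz
  obtain ⟨y, hy, w, hw, rfl⟩ := AddSubgroup.mem_sup.1 hz
  obtain ⟨j, rfl⟩ := AddSubgroup.mem_zmultiples_iff.1 hw
  -- If `k ∣ j`, the step is killed and the element already lies in `Γ`.
  have key : (k : ℤ) ∣ j → (((y + j • (g, f₀ + step t c)).1 = 0) ↔
      (y + j • (g, f₀ + step t c)).2 = 0) := by
    rintro ⟨m, rfl⟩
    refine hΓ _ (add_mem hy ?_)
    have h0 : (k : ℤ) • step t c = 0 := by
      rw [zsmul_step, ← hc, natCast_zsmul, addOrderOf_nsmul_eq_zero, step_zero]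
    rw [mul_comm, mul_smul]
    have : (k : ℤ) • (g, f₀ + step t c) = ((k : ℤ) • g, (k : ℤ) • f₀) := by
      rw [Prod.smul_mk, smul_add, h0, add_zero]
    rw [this]
    exact zsmul_mem hk m
  constructor
  · intro h
    refine (key (hg j ?_)).1 h
    have h' : y.1 + j • g = 0 := h
    rw [← neg_eq_of_add_eq_zero_right h']
    exact neg_mem ⟨y, hy, rfl⟩
  · intro h
    refine (key ?_).2 h
    have h' : y.2 + j • (f₀ + step t c) = 0 := h
    rw [← hc, addOrderOf_dvd_iff_zsmul_eq_zero]
    apply ht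
    have : step t (j • c) = -y.2 + -(j • f₀) := by
      rw [← zsmul_step, smul_add] at *
      rw [eq_comm, ← sub_eq_zero, ← neg_eq_zero, ← h']
      abel
    rw [this]
    exact add_mem ((le_sup_left : _ ≤ _ ⊔ AddSubgroup.zmultiples f₀) (neg_mem ⟨y, hy, rfl⟩))
      ((le_sup_right : _ ≤ Γ.map (AddMonoidHom.snd G (HM A)) ⊔ _)
        (neg_mem (zsmul_mem (AddSubgroup.mem_zmultiples f₀) j)))

end HM

/-! ### Countable closures, orders and division in the circle -/

theorem AddSubgroup.countable_closure {M : Type*} [AddCommGroup M] {s : Set M}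
    (hs : s.Countable) : (AddSubgroup.closure s : Set M).Countable := by
  have : Countable s := hs.to_subtype
  have h : (Set.range (Finsupp.linearCombination ℤ ((↑) : s → M))).Countable :=
    Set.countable_range _
  refine h.mono ?_
  rw [← LinearMap.coe_range, Finsupp.range_linearCombination, Subtype.range_coe,
    ← Submodule.coe_toAddSubgroup, Submodule.span_int_eq_addSubgroupClosure]

theorem UnitAddCircle.exists_addOrderOf_eq (k : ℕ) : ∃ c : UnitAddCircle, addOrderOf c = k := by
  rcases Nat.eq_zero_or_pos k with rfl | hk
  · refine ⟨((√2 : ℝ) : UnitAddCircle), ?_⟩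
    rw [addOrderOf_eq_zero_iff']
    intro n hn h
    rw [← AddCircle.coe_nsmul, AddCircle.coe_eq_zero_iff] at h
    obtain ⟨m, hm⟩ := h
    refine (irrational_sqrt_two.natCast_mul hn.ne').ne_int m ?_
    simpa using hm.symm
  · exact ⟨_, AddCircle.addOrderOf_period_div hk⟩

/-- The solutions of `k • q = p` are spaced `1 / k` apart. The last clause lets the choice of `q` be
applied pointwise to elements of `HM`, through `exists_map₂`. -/
theorem UnitAddCircle.exists_zsmul_eq_norm_sub_le {k : ℕ} (hk : 0 < k) (p d : UnitAddCircle) :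
    ∃ q : UnitAddCircle, (k : ℤ) • q = p ∧ ‖q - d‖ ≤ 1 / k ∧ (p = 0 → d = 0 → q = 0) := by
  by_cases h0 : p = 0 ∧ d = 0
  · refine ⟨0, by simp [h0.1], ?_, fun _ _ => rfl⟩
    rw [h0.2, sub_zero, norm_zero]
    positivity
  obtain ⟨a, rfl⟩ := QuotientAddGroup.mk_surjective p
  obtain ⟨b, rfl⟩ := QuotientAddGroup.mk_surjective d
  have hk' : (0 : ℝ) < k := by exact_mod_cast hk
  refine ⟨(((a + round (k * b - a)) / k : ℝ) : UnitAddCircle), ?_, ?_, fun h h' =>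
    absurd ⟨h, h'⟩ h0⟩
  · rw [← AddCircle.coe_zsmul]
    have : (k : ℤ) • ((a + round (k * b - a)) / k : ℝ) = a + round (k * b - a) := by
      rw [zsmul_eq_mul]
      push_cast
      field_simp
    have hz : ((round (k * b - a) : ℝ) : UnitAddCircle) = 0 :=
      (AddCircle.coe_eq_zero_iff 1).2 ⟨round (k * b - a), by simp⟩
    rw [this, AddCircle.coe_add, hz, add_zero]
  · have h1 := abs_sub_round (k * b - a)
    rw [abs_sub_comm] at h1
    have h2 : (a + round (k * b - a)) / k - b = (round (k * b - a) - (k * b - a)) / k := by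
      field_simp
      ring
    calc _ = ‖(((a + round (k * b - a)) / k - b : ℝ) : UnitAddCircle)‖ := rfl
      _ ≤ |(a + round (k * b - a)) / k - b| := by
        rw [UnitAddCircle.norm_eq]
        simpa using round_le ((a + round (k * b - a)) / k - b) 0
      _ ≤ 1 / k := by
        rw [h2, abs_div, abs_of_pos hk']
        gcongr
        linarith

/-! ### Neighbourhoods, separability and approximate division in `HM` -/

namespace HM

section Topology

variable {A : Type*}

theorem exists_nhd_subset [AddCommGroup A] [TopologicalSpace A] [IsTopologicalAddGroup A]
    {O : Set (HM A)} (hO : O ∈ nhds 0) :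
    ∃ U ∈ nhds (0 : A), ∃ ε : ℝ, 0 < ε ∧ nhd U ε ⊆ O := by
  obtain ⟨_, ⟨U, hU, hU0, ε, hε, rfl⟩, h⟩ := (filterBasis A).nhds_zero_hasBasis.mem_iff.1 hO
  exact ⟨U, hU.mem_nhds hU0, ε, hε, h⟩

theorem exists_ball_nhd_subset [NormedAddCommGroup A] {O : Set (HM A)} (hO : O ∈ nhds 0) :
    ∃ n : ℕ, nhd (Metric.ball (0 : A) (1 / (n + 1))) (1 / (n + 1)) ⊆ O := by
  obtain ⟨U, hU, ε, hε, h⟩ := exists_nhd_subset hO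
  obtain ⟨δ, hδ, hδU⟩ := Metric.mem_nhds_iff.1 hU
  obtain ⟨n, hn⟩ := exists_nat_one_div_lt (lt_min hδ hε)
  refine ⟨n, fun f hf => h ?_⟩
  refine lt_of_le_of_lt (measure_mono fun t (ht : f t ∉ U) (h : f t ∈ Metric.ball 0 _) =>
      ht (hδU (Metric.ball_subset_ball (hn.le.trans (min_le_left _ _)) h)))
    (lt_of_lt_of_le hf (ENNReal.ofReal_le_ofReal (hn.le.trans (min_le_right _ _))))

theorem continuous_step [AddCommGroup A] [TopologicalSpace A] [IsTopologicalAddGroup A] :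
    Continuous fun p : unitInterval × A => step p.1 p.2 := by
  classical
  rw [continuous_iff_continuousAt]
  rintro ⟨t, g⟩
  rw [ContinuousAt, ← tendsto_sub_nhds_zero_iff]
  intro O hO
  obtain ⟨U, hU, ε, hε, hUO⟩ := exists_nhd_subset hO
  rw [Filter.mem_map]
  have h1 : ∀ᶠ s : unitInterval in nhds t, |(s : ℝ) - t| < ε := by
    have : Filter.Tendsto (fun s : unitInterval => |(s : ℝ) - t|) (nhds t) (nhds |(t : ℝ) - t|) :=
      Continuous.tendsto (by fun_prop) t
    rw [sub_self, abs_zero] at this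
    exact this.eventually_lt_const hε
  have h2 : ∀ᶠ g' : A in nhds g, g' - g ∈ U := by
    have : Filter.Tendsto (fun g' : A => g' - g) (nhds g) (nhds (g - g)) :=
      Continuous.tendsto (by fun_prop) g
    rw [sub_self] at this
    exact this hU
  rw [nhds_prod_eq]
  filter_upwards [h1.prod_mk h2] with p hp
  obtain ⟨hp1, hp2⟩ := hp
  apply hUO
  -- Outside the interval between the two jumps, the difference is `p.2 - g` or `0`.
  have hsub : {x : unitInterval | (step p.1 p.2 - step t g) x ∉ U} ⊆
      Set.Ico (min p.1 t) (max p.1 t) := by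
    intro x hx
    rw [Set.mem_ofPred_eq, sub_apply, step_apply, step_apply] at hx
    refine ⟨?_, ?_⟩
    · by_contra h
      rw [not_le, lt_min_iff] at h
      rw [if_pos h.1, if_pos h.2] at hx
      exact hx hp2
    · by_contra h
      rw [not_lt, max_le_iff] at h
      rw [if_neg (not_lt.2 h.1), if_neg (not_lt.2 h.2), sub_zero] at hx
      exact hx (mem_of_mem_nhds hU)
  refine lt_of_le_of_lt (measure_mono hsub) ?_
  rw [unitInterval.volume_Ico]
  refine (ENNReal.ofReal_lt_ofReal_iff hε).2 ?_
  have : ((max p.1 t : unitInterval) : ℝ) - (min p.1 t : unitInterval) = |(p.1 : ℝ) - t| := by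
    rcases le_total p.1 t with h | h
    · have h' : (p.1 : ℝ) ≤ t := h
      rw [max_eq_right h, min_eq_left h, abs_of_nonpos (by linarith)]
      ring
    · have h' : (t : ℝ) ≤ p.1 := h
      rw [max_eq_left h, min_eq_right h, abs_of_nonneg (by linarith)]
  rw [this]
  exact hp1

theorem separableSpace [AddCommGroup A] [TopologicalSpace A] [IsTopologicalAddGroup A]
    [TopologicalSpace.SeparableSpace A] : TopologicalSpace.SeparableSpace (HM A) := by
  obtain ⟨D, hDc, hD⟩ := TopologicalSpace.exists_countable_dense (unitInterval × A)
  let C := AddSubgroup.closure ((fun p : unitInterval × A => step p.1 p.2) '' D)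
  refine ⟨C, AddSubgroup.countable_closure (hDc.image _), ?_⟩
  have h : (⊤ : AddSubgroup (HM A)) ≤ C.topologicalClosure := by
    rw [← closure_step, AddSubgroup.closure_le]
    rintro _ ⟨t, g, rfl⟩
    exact closure_mono AddSubgroup.subset_closure
      (image_closure_subset_closure_image continuous_step ⟨(t, g), hD _, rfl⟩)
  exact fun f => h (AddSubgroup.mem_top f)

end Topology

theorem exists_zsmul_eq_norm_sub_le {k : ℕ} (hk : 0 < k) (p d : HM UnitAddCircle) :
    ∃ f : HM UnitAddCircle, (k : ℤ) • f = p ∧ ∀ x, ‖f x - d x‖ ≤ 1 / k := by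
  choose F hF using UnitAddCircle.exists_zsmul_eq_norm_sub_le hk
  obtain ⟨f, hf⟩ := exists_map₂ F ((hF 0 0).2.2 rfl rfl) p d
  refine ⟨f, ?_, fun x => ?_⟩
  · ext x
    rw [zsmul_apply, hf, (hF _ _).1]
  · rw [hf]
    exact (hF _ _).2.1

end HM

/-! ### Large orders modulo finitely generated subgroups -/

theorem AddSubgroup.FG.exists_nsmul_eq_zero_of_isOfFinAddOrder {G : Type*} [AddCommGroup G]
    {H : AddSubgroup G} (hH : H.FG) :
    ∃ n : ℕ, 0 < n ∧ ∀ h ∈ H, IsOfFinAddOrder h → n • h = 0 := by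
  have : Module.Finite ℤ H := Module.Finite.iff_addGroup_fg.2
    ((AddGroup.fg_iff_addSubgroup_fg H).2 hH)
  have hT : (AddSubgroup.toIntSubmodule (AddCommGroup.torsion H)).FG := IsNoetherian.noetherian _
  have : AddGroup.FG (AddCommGroup.torsion H) := Module.Finite.iff_addGroup_fg.1
    (Module.Finite.iff_fg.2 hT)
  have : Finite (AddCommGroup.torsion H) :=
    AddCommGroup.finite_of_fg_isAddTorsion _ fun x =>
      AddSubmonoid.isOfFinAddOrder_coe.1 ((AddCommGroup.mem_torsion _).1 x.2)
  obtain ⟨n, hn, h⟩ := AddMonoid.ExponentExists.of_finite (G := AddCommGroup.torsion H)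
  refine ⟨n, hn, fun x hx hfin => ?_⟩
  have hx' : (⟨x, hx⟩ : H) ∈ AddCommGroup.torsion H :=
    (AddCommGroup.mem_torsion _).2 (AddSubmonoid.isOfFinAddOrder_coe.1 hfin)
  exact congrArg (fun y : AddCommGroup.torsion H => ((y : H) : G)) (h ⟨_, hx'⟩)

/-- If the torsion part of `G` is unbounded or the rank is infinite, then the quotient of `G` by a
finitely generated subgroup is unbounded. -/
theorem exists_nsmul_notMem_of_fg {G : Type*} [AddCommGroup G]
    (hG : ¬ AddMonoid.ExponentExists (AddCommGroup.torsion G) ∨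
      Cardinal.aleph0 ≤ Module.rank ℤ G) {H : AddSubgroup G} (hH : H.FG) {n : ℕ} (hn : 0 < n) :
    ∃ g : G, n • g ∉ H := by
  by_contra! hcon
  -- Now `n • G ⊆ H`. If `m` kills the torsion of `H`, then `m * n` kills that of `G`; also `G ⧸ H`
  -- is torsion, so `G` has the finite rank of `H`.
  rcases hG with hG | hG
  · obtain ⟨m, hm, h⟩ := hH.exists_nsmul_eq_zero_of_isOfFinAddOrder
    refine hG ⟨m * n, Nat.mul_pos hm hn, fun g => Subtype.ext ?_⟩
    have hg : IsOfFinAddOrder (g : G) := (AddCommGroup.mem_torsion _).1 g.2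
    have := h _ (hcon g) hg.nsmul
    rwa [← mul_nsmul'] at this
  · let N := AddSubgroup.toIntSubmodule H
    have h0 : Module.rank ℤ (G ⧸ N) = 0 := by
      rw [rank_eq_zero_iff]
      intro x
      obtain ⟨g, rfl⟩ := Submodule.Quotient.mk_surjective N x
      refine ⟨n, by exact_mod_cast hn.ne', ?_⟩
      rw [← Submodule.Quotient.mk_smul, Submodule.Quotient.mk_eq_zero, natCast_zsmul]
      exact hcon g
    have h1 := Submodule.rank_quotient_add_rank N
    rw [h0, zero_add] at h1
    have : Module.Finite ℤ N := Module.Finite.iff_addGroup_fg.2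
      ((AddGroup.fg_iff_addSubgroup_fg H).2 hH)
    exact absurd (h1 ▸ Module.rank_lt_aleph0 ℤ N) (not_lt.2 hG)

theorem exists_order_modulo_gt {G : Type*} [AddCommGroup G]
    (hG : ¬ AddMonoid.ExponentExists (AddCommGroup.torsion G) ∨
      Cardinal.aleph0 ≤ Module.rank ℤ G) {H : AddSubgroup G} (hH : H.FG) (n : ℕ) :
    ∃ g : G, ∃ k : ℕ, (k = 0 ∨ n < k) ∧ ∀ j : ℤ, j • g ∈ H ↔ (k : ℤ) ∣ j := by
  -- An order `k` with `0 < k ≤ n` would divide `n!`.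
  obtain ⟨g, hg⟩ := exists_nsmul_notMem_of_fg hG hH n.factorial_pos
  obtain ⟨k, hk⟩ := H.exists_dvd_iff_zsmul_mem g
  refine ⟨g, k, ?_, hk⟩
  by_contra! hcon
  refine hg ?_
  rw [← natCast_zsmul, hk]
  exact_mod_cast Nat.dvd_factorial (Nat.pos_of_ne_zero hcon.1) hcon.2

theorem AddSubgroup.IsPartialIso.exists_equiv {G B : Type*} [AddCommGroup G] [AddCommGroup B]
    {Γ : AddSubgroup (G × B)} (hΓ : Γ.IsPartialIso) (h : ∀ g, ∃ b, (g, b) ∈ Γ) :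
    Nonempty (G ≃+ Γ.map (AddMonoidHom.snd G B)) := by
  have h1 : Function.Bijective ((AddMonoidHom.fst G B).comp Γ.subtype) := by
    refine ⟨(injective_iff_map_eq_zero _).2 fun z hz => ?_, fun g => ?_⟩
    · exact Subtype.ext (Prod.ext hz ((hΓ z z.2).1 hz))
    · obtain ⟨b, hb⟩ := h g
      exact ⟨⟨_, hb⟩, rfl⟩
  have h2 : Function.Bijective ((AddMonoidHom.snd G B).addSubgroupMap Γ) := by
    refine ⟨(injective_iff_map_eq_zero _).2 fun z hz => ?_,
      AddMonoidHom.addSubgroupMap_surjective _ _⟩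
    have hz' : (z : G × B).2 = 0 := congrArg Subtype.val hz
    exact Subtype.ext (Prod.ext ((hΓ z z.2).2 hz') hz')
  exact ⟨(AddEquiv.ofBijective _ h1).symm.trans (AddEquiv.ofBijective _ h2)⟩

/-! ### The two extension steps over the circle -/

namespace HM

variable {G : Type*} [AddCommGroup G]

theorem exists_partialIso_extension_mem_domain {Γ : AddSubgroup (G × HM UnitAddCircle)}
    (hfg : Γ.FG) (hΓ : Γ.IsPartialIso) (g : G) :
    ∃ Γ' : AddSubgroup (G × HM UnitAddCircle), Γ ≤ Γ' ∧ Γ'.FG ∧ Γ'.IsPartialIso ∧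
      ∃ f, (g, f) ∈ Γ' := by
  obtain ⟨k, hk⟩ := (Γ.map (AddMonoidHom.fst G _)).exists_dvd_iff_zsmul_mem g
  obtain ⟨z, hz, hzg⟩ := (hk k).2 dvd_rfl
  obtain ⟨f₀, hf₀⟩ : ∃ f₀ : HM UnitAddCircle, ((k : ℤ) • g, (k : ℤ) • f₀) ∈ Γ := by
    rcases Nat.eq_zero_or_pos k with rfl | hk0
    · exact ⟨0, by rw [Nat.cast_zero, zero_smul, zero_smul]; exact zero_mem Γ⟩
    · obtain ⟨f, hf, -⟩ := exists_zsmul_eq_norm_sub_le hk0 z.2 0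
      refine ⟨f, ?_⟩
      rw [hf, ← hzg]
      exact hz
  obtain ⟨c, hc⟩ := UnitAddCircle.exists_addOrderOf_eq k
  obtain ⟨Γ', h1, h2, h3, t, -, h4⟩ :=
    exists_partialIso_extension hfg hΓ hf₀ (fun j => (hk j).1) hc one_pos
  exact ⟨Γ', h1, h2, h3, _, h4⟩

theorem exists_partialIso_extension_near
    (hG : ¬ AddMonoid.ExponentExists (AddCommGroup.torsion G) ∨
      Cardinal.aleph0 ≤ Module.rank ℤ G)
    {Γ : AddSubgroup (G × HM UnitAddCircle)}
    (hfg : Γ.FG) (hΓ : Γ.IsPartialIso) (d : HM UnitAddCircle) {ε : ℝ} (hε : 0 < ε) :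
    ∃ Γ' : AddSubgroup (G × HM UnitAddCircle), Γ ≤ Γ' ∧ Γ'.FG ∧ Γ'.IsPartialIso ∧
      ∃ z ∈ Γ', z.2 - d ∈ nhd (Metric.ball 0 ε) ε := by
  classical
  obtain ⟨n, hn⟩ := exists_nat_one_div_lt hε
  obtain ⟨g, k, hkn, hk⟩ := exists_order_modulo_gt hG (hfg.map_hom (AddMonoidHom.fst G _)) n
  obtain ⟨z, hz, hzg⟩ := (hk k).2 dvd_rfl
  obtain ⟨f₀, hf₀, hd⟩ : ∃ f₀ : HM UnitAddCircle, ((k : ℤ) • g, (k : ℤ) • f₀) ∈ Γ ∧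
      ∀ x, ‖f₀ x - d x‖ < ε := by
    rcases hkn with rfl | hkn
    · exact ⟨d, by rw [Nat.cast_zero, zero_smul, zero_smul]; exact zero_mem Γ,
        fun x => by rwa [sub_self, norm_zero]⟩
    · obtain ⟨f, hf, hfd⟩ := exists_zsmul_eq_norm_sub_le (n.zero_le.trans_lt hkn) z.2 d
      refine ⟨f, ?_, fun x => (hfd x).trans_lt (lt_of_le_of_lt ?_ hn)⟩
      · rw [hf, ← hzg]
        exact hz
      · refine one_div_le_one_div_of_le (by positivity) ?_
        exact_mod_cast hkn
  obtain ⟨c, hc⟩ := UnitAddCircle.exists_addOrderOf_eq k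
  obtain ⟨Γ', h1, h2, h3, t, ht, h4⟩ :=
    exists_partialIso_extension hfg hΓ hf₀ (fun j => (hk j).1) hc hε
  refine ⟨Γ', h1, h2, h3, _, h4, ?_⟩
  -- The step may be large, but only on `[0, t)`, of measure `t < ε`.
  have hsub : {x : unitInterval | (f₀ + step t c - d) x ∉ Metric.ball (0 : UnitAddCircle) ε} ⊆
      Set.Iio t := by
    intro x hx
    by_contra hxt
    rw [Set.mem_ofPred_eq, sub_apply, add_apply, step_apply, if_neg (show ¬ x < t from hxt), add_zero,
      mem_ball_zero_iff] at hx
    exact hx (hd x)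
  refine lt_of_le_of_lt (measure_mono hsub) ?_
  rw [unitInterval.volume_Iio]
  exact (ENNReal.ofReal_lt_ofReal_iff hε).2 ht

end HM

/-! ### The generic union of partial isomorphisms -/

theorem theorem8p7 (G : Type*) [AddCommGroup G] [Countable G]
    (hG : ¬ AddMonoid.ExponentExists (AddCommGroup.torsion G) ∨
      Cardinal.aleph0 ≤ Module.rank ℤ G) :
    ∃ D : AddSubgroup (HM UnitAddCircle),
      Dense (D : Set (HM UnitAddCircle)) ∧ Nonempty (G ≃+ D) := by
  have := HM.separableSpace (A := UnitAddCircle)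
  obtain ⟨C, hCc, hC⟩ := TopologicalSpace.exists_countable_dense (HM UnitAddCircle)
  have : Countable C := hCc.to_subtype
  have : Encodable (G ⊕ C × ℕ) := Encodable.ofCountable _
  let P := {Γ : AddSubgroup (G × HM UnitAddCircle) // Γ.FG ∧ Γ.IsPartialIso}
  let p₀ : P := ⟨⊥, ⟨∅, by simp⟩, fun z hz => by
    rw [AddSubgroup.mem_bot] at hz
    simp [hz]⟩
  -- Left indices ensure full domain, right ones density; an ideal meeting all these cofinal sets is
  -- directed, so its union is again a partial isomorphism.
  let 𝒟 : G ⊕ C × ℕ → Order.Cofinal P := Sum.elim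
    (fun g => ⟨{Γ | ∃ f, (g, f) ∈ Γ.1}, fun Γ => by
      obtain ⟨Γ', h1, h2, h3, h4⟩ := HM.exists_partialIso_extension_mem_domain Γ.2.1 Γ.2.2 g
      exact ⟨⟨Γ', h2, h3⟩, h4, h1⟩⟩)
    (fun q => ⟨{Γ | ∃ z ∈ Γ.1, z.2 - (q.1 : HM UnitAddCircle) ∈
        HM.nhd (Metric.ball 0 (1 / ((q.2 : ℝ) + 1))) (1 / ((q.2 : ℝ) + 1))}, fun Γ => by
      obtain ⟨Γ', h1, h2, h3, h4⟩ := HM.exists_partialIso_extension_near hG Γ.2.1 Γ.2.2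
        (q.1 : HM UnitAddCircle) (Nat.one_div_pos_of_nat (n := q.2))
      exact ⟨⟨Γ', h2, h3⟩, h4, h1⟩⟩)
  let I := Order.idealOfCofinals p₀ 𝒟
  let Γ : AddSubgroup (G × HM UnitAddCircle) := ⨆ i : I, i.1.1
  have hne : Nonempty I := ⟨⟨p₀, Order.mem_idealOfCofinals p₀ 𝒟⟩⟩
  have hmem : ∀ z, z ∈ Γ ↔ ∃ i : I, z ∈ i.1.1 := fun z => by
    refine AddSubgroup.mem_iSup_of_directed fun i j => ?_
    obtain ⟨l, hl, hil, hjl⟩ := I.directed i.1 i.2 j.1 j.2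
    exact ⟨⟨l, hl⟩, hil, hjl⟩
  have hΓ : Γ.IsPartialIso := fun z hz => by
    obtain ⟨i, hi⟩ := (hmem z).1 hz
    exact i.1.2.2 z hi
  refine ⟨Γ.map (AddMonoidHom.snd G _), ?_, hΓ.exists_equiv fun g => ?_⟩
  · have hsub : C ⊆ closure (Γ.map (AddMonoidHom.snd G (HM UnitAddCircle)) : Set _) := by
      intro d hd
      rw [mem_closure_iff_nhds]
      intro O hO
      have hO' : (fun f => f + d) ⁻¹' O ∈ nhds (0 : HM UnitAddCircle) :=
        (continuous_add_const d).continuousAt.preimage_mem_nhds (by simpa using hO)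
      obtain ⟨n, hn⟩ := HM.exists_ball_nhd_subset hO'
      obtain ⟨i, ⟨z, hz, hzd⟩, hi⟩ :=
        Order.cofinal_meets_idealOfCofinals p₀ 𝒟 (Sum.inr (⟨d, hd⟩, n))
      refine ⟨z.2, ?_, z, (hmem z).2 ⟨⟨i, hi⟩, hz⟩, rfl⟩
      have := hn hzd
      rwa [Set.mem_preimage, sub_add_cancel] at this
    exact fun f => closure_minimal hsub isClosed_closure (hC f)
  · obtain ⟨i, ⟨f, hf⟩, hi⟩ := Order.cofinal_meets_idealOfCofinals p₀ 𝒟 (Sum.inl g)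
    exact ⟨f, (hmem _).2 ⟨⟨i, hi⟩, hf⟩⟩
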